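/- Let $n\ge 2$, let $P\in\mathbb R^n$, let $|\cdot|$ be the Euclidean norm, and for $\kappa,b\in\mathbb R$ let $$S_{\kappa,b}=\{X\in\mathbb R^n : |X|+\kappa\,|X-P|=b\}.$$ The region enclosed by a surface $S\subset\mathbb R^n$ is the union of $S$ with the bounded connected components of $\mathbb R^n\setminus S$. The surface $S$ is called convex if the region it encloses is a convex set, and concave if every point of $S$ is the center of an open ball whose intersection with the complement of the enclosed region is convex (in particular, $S$ is concave if the complement of the enclosed region is convex). 1. Suppose $-1<\kappa<0$. Then $S_{\kappa,b}$ is (a) convex when $b\in[\kappa|P|,(1+\kappa)|P|]$; (b) neither convex nor concave when $b\in((1+\kappa)|P|,|P|)$. 2. Suppose $\kappa<-1$. Then $S_{\kappa,b}$ is (a) convex when $b\in[(1+\kappa)|P|,|P|)$; (b) neither convex nor concave when $b\in(\kappa|P|,(1+\kappa)|P|)$. -/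

import Mathlib

/-- The surface `|X| + κ |X - P| = b` in Euclidean `n`-space. -/
def oval {n : ℕ} (κ : ℝ) (P : EuclideanSpace ℝ (Fin n)) (b : ℝ) :
    Set (EuclideanSpace ℝ (Fin n)) :=
  {X | ‖X‖ + κ * ‖X - P‖ = b}

/-- The closed region enclosed by a surface `S`: the points of `S`, together with all bounded
connected components of the complement of `S`. -/
def enclosedRegion {n : ℕ} (S : Set (EuclideanSpace ℝ (Fin n))) :
    Set (EuclideanSpace ℝ (Fin n)) :=
  S ∪ {X | X ∉ S ∧ Bornology.IsBounded (connectedComponentIn Sᶜ X)}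

/-- A surface is convex if the region that it encloses is a convex set. -/
def IsConvexSurface {n : ℕ} (S : Set (EuclideanSpace ℝ (Fin n))) : Prop :=
  Convex ℝ (enclosedRegion S)

/-- A surface is concave if, near each of its points, the region outside of it is convex, that is,
the surface bends everywhere away from the side that it encloses. (If the whole outer region is
convex, then the surface is concave in this sense, so that failing to be concave here is the
stronger assertion.) -/
def IsConcaveSurface {n : ℕ} (S : Set (EuclideanSpace ℝ (Fin n))) : Prop :=
  ∀ X ∈ S, ∃ r > 0, Convex ℝ (Metric.ball X r ∩ (enclosedRegion S)ᶜ)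

/-!
With the weight `k = -κ` (or `k = -κ⁻¹`, after exchanging the two foci) the surface is a level set
`f = b` of `f X = |X - A| - k |X - B|` with `0 < k < 1`. Since `f` does not decrease when moving
away from `A` along a ray, and has bounded sublevel sets, the region enclosed is `{f ≤ b}`.

Everything about its shape is governed by the comparison of `k |Z - A|` with `|Z - B|` at a point
`Z` of the surface. If `k |Z - A| ≤ |Z - B|`, which holds at every `Z` when `b ≤ (1 - k) |A - B|`,
the region lies on one side of the tangent hyperplane at `Z`. On the line through the foci the
second variation of `f` orthogonal to that line has the sign of `|Z - B| - k |Z - A|`: it is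
negative at the vertex between the foci when `(1 - k) |A - B| < b`, which prevents convexity, and
positive at the vertex beyond `A`, which prevents concavity.
-/

open Set Metric Bornology Topology
open AffineMap (lineMap)
open scoped RealInnerProductSpace

section Region

/-- The region enclosed by a set `S`: the points of `S` and of the bounded components of its
complement. This is `enclosedRegion` in an arbitrary ambient space. -/
def boundedFill {X : Type*} [TopologicalSpace X] [Bornology X] (S : Set X) : Set X :=
  S ∪ {x | x ∉ S ∧ IsBounded (connectedComponentIn Sᶜ x)}

/-- Concavity of a surface `S`: near each of its points, the outside of the region it encloses is
convex. This is `IsConcaveSurface` in an arbitrary normed space. -/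
def IsLocallyConvexOutside {E : Type*} [NormedAddCommGroup E] [NormedSpace ℝ E] (S : Set E) :
    Prop :=
  ∀ x ∈ S, ∃ r > 0, Convex ℝ (ball x r ∩ (boundedFill S)ᶜ)

theorem boundedFill_setOf_eq {X : Type*} [TopologicalSpace X] [Bornology X] {f : X → ℝ} {b : ℝ}
    (hf : Continuous f) (hbdd : IsBounded {x | f x < b})
    (hunbdd : ∀ x, b < f x → ∃ C, IsPreconnected C ∧ ¬ IsBounded C ∧ x ∈ C ∧ ∀ y ∈ C, b < f y) :
    boundedFill {x | f x = b} = {x | f x ≤ b} := by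
  ext x
  refine ⟨?_, fun hx => ?_⟩
  · rintro (hx | ⟨-, hcomp⟩)
    · exact le_of_eq hx
    · by_contra hgt
      obtain ⟨C, hC, hCunbdd, hxC, hCb⟩ := hunbdd x (not_le.1 hgt)
      exact hCunbdd (hcomp.subset
        (hC.subset_connectedComponentIn hxC fun y hy => (hCb y hy).ne'))
  · rcases eq_or_lt_of_le (show f x ≤ b from hx) with hx | hx
    · exact Or.inl hx
    refine Or.inr ⟨hx.ne, hbdd.subset fun y hy => ?_⟩
    by_contra hyb
    obtain ⟨v, hv, hvb⟩ := isPreconnected_connectedComponentIn.intermediate_value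
      (mem_connectedComponentIn (F := {x | f x = b}ᶜ) hx.ne) hy hf.continuousOn
      ⟨hx.le, not_lt.1 hyb⟩
    exact connectedComponentIn_subset _ _ hv hvb

end Region

theorem not_isBounded_lineMap_image_Ici {E : Type*} [NormedAddCommGroup E] [NormedSpace ℝ E]
    {x y : E} (h : x ≠ y) (a : ℝ) : ¬ IsBounded (lineMap x y '' Ici a) := fun hbdd =>
  not_bddAbove_Ici a <| (((antilipschitzWith_lineMap h).isBounded_preimage hbdd).subset
    (subset_preimage_image _ _)).bddAbove

theorem convex_setOf_le_of_supporting {E : Type*} [AddCommGroup E] [Module ℝ E]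
    [TopologicalSpace E] [IsTopologicalAddGroup E] [ContinuousSMul ℝ E] {f : E → ℝ} {b : ℝ} {a : E}
    (hf : Continuous f) (ha : f a < b)
    (hsupp : ∀ z, f z = b → ∃ N : E →ₗ[ℝ] ℝ, N a < N z ∧ ∀ v, f v ≤ b → N v ≤ N z) :
    Convex ℝ {x | f x ≤ b} := by
  rw [convex_iff_segment_subset]
  intro x hx y hy w hw
  by_contra hwb
  obtain ⟨t, ⟨ht0, ht1⟩, htb⟩ : b ∈ (fun t : ℝ => f (lineMap a w t)) '' Ioo 0 1 :=
    intermediate_value_Ioo zero_le_one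
      (hf.comp AffineMap.lineMap_continuous).continuousOn (by simpa using ⟨ha, not_le.1 hwb⟩)
  obtain ⟨N, hNa, hN⟩ := hsupp _ htb
  have hNw : N w ≤ N (lineMap a w t) :=
    (convex_halfSpace_le N.isLinear _).segment_subset (hN x hx) (hN y hy) hw
  have hNz : N (lineMap a w t) = (1 - t) * N a + t * N w := by
    rw [← AffineMap.lineMap_apply_ring]
    exact N.toAffineMap.apply_lineMap a w t
  nlinarith

theorem mem_of_convex_of_add_mem_of_add_neg_mem {E : Type*} [AddCommGroup E] [Module ℝ E]
    {s : Set E} {x h : E} (hs : Convex ℝ s) (hadd : x + h ∈ s) (hneg : x + -h ∈ s) : x ∈ s := by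
  simpa [← sub_eq_add_neg] using hs.midpoint_mem hadd hneg

theorem exists_norm_eq_inner_eq_zero {E : Type*} [NormedAddCommGroup E] [InnerProductSpace ℝ E]
    (hE : 1 < Module.rank ℝ E) (v : E) {r : ℝ} (hr : 0 ≤ r) : ∃ h : E, ‖h‖ = r ∧ ⟪v, h⟫ = 0 := by
  have hne : (ℝ ∙ v)ᗮ ≠ ⊥ := by
    rw [Ne, Submodule.orthogonal_eq_bot_iff]
    intro htop
    refine hE.not_ge ?_
    rw [← rank_top ℝ E, ← htop]
    exact (rank_span_le _).trans_eq (Cardinal.mk_singleton v)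
  have : Nontrivial (ℝ ∙ v)ᗮ := Submodule.nontrivial_iff_ne_bot.2 hne
  obtain ⟨h, hh⟩ := exists_norm_eq (ℝ ∙ v)ᗮ hr
  exact ⟨h, hh, Submodule.mem_orthogonal_singleton_iff_inner_right.1 h.2⟩

/-- The weighted difference of the distances to the foci `A` and `B`; its level sets are the
Cartesian ovals. -/
def focalDiff {X : Type*} [Dist X] (k : ℝ) (A B x : X) : ℝ := dist x A - k * dist x B

section Metric

variable {X : Type*} [PseudoMetricSpace X] {k : ℝ} {A B x : X}

theorem continuous_focalDiff (k : ℝ) (A B : X) : Continuous (focalDiff k A B) := by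
  unfold focalDiff
  fun_prop

theorem focalDiff_left (k : ℝ) (A B : X) : focalDiff k A B A = -(k * dist A B) := by
  simp [focalDiff]

theorem mul_dist_le_focalDiff_add (hk : 0 ≤ k) :
    (1 - k) * dist x A ≤ focalDiff k A B x + k * dist A B := by
  unfold focalDiff
  linarith [mul_le_mul_of_nonneg_left (dist_triangle x A B) hk]

theorem isBounded_focalDiff_lt (hk : 0 ≤ k) (hk1 : k < 1) (b : ℝ) :
    IsBounded {x | focalDiff k A B x < b} := by
  refine (isBounded_closedBall (x := A) (r := (b + k * dist A B) / (1 - k))).subset fun x hx => ?_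
  rw [mem_closedBall, le_div_iff₀' (sub_pos.2 hk1)]
  have hxb : focalDiff k A B x < b := hx
  linarith [mul_dist_le_focalDiff_add (A := A) (B := B) (x := x) hk]

theorem mul_dist_le_dist_of_focalDiff_le (hk1 : k ≤ 1)
    (hx : focalDiff k A B x ≤ (1 - k) * dist A B) : k * dist x A ≤ dist x B := by
  unfold focalDiff at hx
  linarith [mul_le_mul_of_nonneg_left (dist_triangle_left A B x) (sub_nonneg.2 hk1)]

theorem dist_lt_mul_dist_of_lt_focalDiff (hx : dist A x + dist x B = dist A B)
    (hlt : (1 - k) * dist A B < focalDiff k A B x) : dist x B < k * dist x A := by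
  rw [focalDiff, ← hx, dist_comm A x] at hlt
  linarith

end Metric

section Normed

variable {E : Type*} [NormedAddCommGroup E] [NormedSpace ℝ E] {k b : ℝ} {A B : E}

theorem focalDiff_lineMap (k : ℝ) (A B : E) (t : ℝ) :
    focalDiff k A B (lineMap A B t) = (|t| - k * |1 - t|) * dist A B := by
  rw [focalDiff, dist_lineMap_left, dist_lineMap_right, Real.norm_eq_abs, Real.norm_eq_abs]
  ring

theorem focalDiff_le_focalDiff_lineMap (hk : 0 ≤ k) (hk1 : k ≤ 1) (A B x : E) {t : ℝ}
    (ht : 1 ≤ t) : focalDiff k A B x ≤ focalDiff k A B (lineMap A x t) := by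
  have hA : dist (lineMap A x t) A = t * dist x A := by
    rw [dist_lineMap_left, Real.norm_of_nonneg (by linarith), dist_comm]
  have hB : dist (lineMap A x t) B ≤ (t - 1) * dist x A + dist x B := by
    refine (dist_triangle _ x _).trans_eq ?_
    rw [dist_lineMap_right, norm_sub_rev, Real.norm_of_nonneg (by linarith), dist_comm A]
  have hgap : 0 ≤ (1 - k) * ((t - 1) * dist x A) :=
    mul_nonneg (by linarith) (mul_nonneg (by linarith) dist_nonneg)
  unfold focalDiff
  linarith [mul_le_mul_of_nonneg_left hB hk]

theorem boundedFill_focalDiff_eq (hk : 0 ≤ k) (hk1 : k < 1) (hb : -(k * dist A B) ≤ b) :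
    boundedFill {x | focalDiff k A B x = b} = {x | focalDiff k A B x ≤ b} := by
  refine boundedFill_setOf_eq (continuous_focalDiff k A B) (isBounded_focalDiff_lt hk hk1 b)
    fun x hx => ?_
  have hAx : A ≠ x := by
    rintro rfl
    exact (focalDiff_left k A B ▸ hx).not_ge hb
  refine ⟨lineMap A x '' Ici (1 : ℝ),
    isPreconnected_Ici.image _ AffineMap.lineMap_continuous.continuousOn,
    not_isBounded_lineMap_image_Ici hAx 1, ⟨1, self_mem_Ici, by simp⟩, ?_⟩
  rintro _ ⟨t, ht, rfl⟩
  exact hx.trans_le (focalDiff_le_focalDiff_lineMap hk hk1.le A B x ht)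

theorem strictMonoOn_focalDiff_lineMap (hk : -1 < k) (hAB : A ≠ B) :
    StrictMonoOn (fun t => focalDiff k A B (lineMap A B t)) (Icc (0 : ℝ) 1) := by
  intro s hs t ht hst
  simp only [focalDiff_lineMap, abs_of_nonneg hs.1, abs_of_nonneg ht.1,
    abs_of_nonneg (sub_nonneg.2 hs.2), abs_of_nonneg (sub_nonneg.2 ht.2)]
  exact mul_lt_mul_of_pos_right (by nlinarith) (dist_pos.2 hAB)

theorem lineMap_notMem_interior_focalDiff_le (hk : -1 < k) (hAB : A ≠ B) {t : ℝ}
    (ht : t ∈ Ioo (0 : ℝ) 1) :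
    lineMap A B t ∉ interior {x | focalDiff k A B x ≤ focalDiff k A B (lineMap A B t)} := by
  intro hint
  have hnear : ∀ᶠ τ in 𝓝[>] t,
      focalDiff k A B (lineMap A B τ) ≤ focalDiff k A B (lineMap A B t) :=
    (AffineMap.lineMap_continuous.tendsto t).mono_left nhdsWithin_le_nhds |>.eventually
      (mem_interior_iff_mem_nhds.1 hint)
  obtain ⟨τ, hle, hτ⟩ := (hnear.and (Ioo_mem_nhdsGT ht.2)).exists
  exact hle.not_gt (strictMonoOn_focalDiff_lineMap hk hAB (Ioo_subset_Icc_self ht)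
    ⟨(ht.1.trans hτ.1).le, hτ.2.le⟩ hτ.1)

theorem exists_focalDiff_lineMap_eq_of_neg (hk1 : k < 1) (hAB : A ≠ B)
    (hb : -(k * dist A B) < b) : ∃ t < (0 : ℝ), focalDiff k A B (lineMap A B t) = b := by
  have hp : 0 < dist A B := dist_pos.2 hAB
  have hd : 0 < (1 - k) * dist A B := mul_pos (sub_pos.2 hk1) hp
  have ht : -((b + k * dist A B) / ((1 - k) * dist A B)) < 0 := by
    rw [neg_lt_zero]
    exact div_pos (by linarith) hd
  refine ⟨_, ht, ?_⟩
  rw [focalDiff_lineMap, abs_of_neg ht, abs_of_pos (by linarith)]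
  have : 1 - k ≠ 0 := (sub_pos.2 hk1).ne'
  field_simp
  ring

theorem exists_focalDiff_lineMap_eq_of_mem_Ioo (hb : -(k * dist A B) < b) (hb' : b < dist A B) :
    ∃ t ∈ Ioo (0 : ℝ) 1, focalDiff k A B (lineMap A B t) = b :=
  intermediate_value_Ioo zero_le_one
    ((continuous_focalDiff k A B).comp AffineMap.lineMap_continuous).continuousOn
    (by simpa [focalDiff, dist_comm B A] using And.intro hb hb')

end Normed

section Inner

variable {E : Type*} [NormedAddCommGroup E] [InnerProductSpace ℝ E] {k b : ℝ} {A B Z h : E}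

/-- A normal vector to the level set of `focalDiff k A B` through `Z`: the gradient at `Z`,
multiplied by `dist Z A * dist Z B` to clear denominators. -/
def focalNormal (k : ℝ) (A B Z : E) : E := dist Z B • (Z - A) - (k * dist Z A) • (Z - B)

/-- When `k * ‖z‖ ≤ ‖w‖` and `|k| ≤ 1`, the last two terms are nonnegative (the first of them by the
Cauchy-Schwarz inequality), so that the inner product decides the sign. -/
theorem norm_mul_sq_norm_add_sub_sq (k : ℝ) (z w h : E) :
    ‖w‖ * (‖z + h‖ ^ 2 - (‖z‖ + k * (‖w + h‖ - ‖w‖)) ^ 2) =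
      2 * ⟪‖w‖ • z - (k * ‖z‖) • w, h⟫ +
        2 * (‖w‖ - k * ‖z‖) * (‖w‖ * ‖w + h‖ - ⟪w, w + h⟫) +
        (1 - k ^ 2) * ‖w‖ * (‖w + h‖ - ‖w‖) ^ 2 := by
  rw [inner_sub_left, real_inner_smul_left, real_inner_smul_left, inner_add_right,
    real_inner_self_eq_norm_sq]
  linear_combination ‖w‖ * norm_add_sq_real z h - ‖w‖ * norm_add_sq_real w h

theorem focalDiff_lt_focalDiff_add_of_inner_pos (hk : 0 ≤ k) (hk1 : k ≤ 1)
    (hZ : k * dist Z A ≤ dist Z B) (hh : 0 < ⟪focalNormal k A B Z, h⟫) :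
    focalDiff k A B Z < focalDiff k A B (Z + h) := by
  have identity := norm_mul_sq_norm_add_sub_sq k (Z - A) (Z - B) h
  have cauchy_schwarz := real_inner_le_norm (Z - B) (Z - B + h)
  simp only [focalDiff, focalNormal, dist_eq_norm, add_sub_right_comm Z h] at hZ hh ⊢
  have hpos : 0 < ‖Z - B‖ *
      (‖Z - A + h‖ ^ 2 - (‖Z - A‖ + k * (‖Z - B + h‖ - ‖Z - B‖)) ^ 2) := by
    rw [identity]
    have := mul_nonneg (sub_nonneg.2 hZ) (sub_nonneg.2 cauchy_schwarz)
    have : 0 ≤ (1 - k ^ 2) * ‖Z - B‖ * (‖Z - B + h‖ - ‖Z - B‖) ^ 2 :=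
      mul_nonneg (mul_nonneg (by nlinarith) (norm_nonneg _)) (sq_nonneg _)
    linarith
  have := lt_of_abs_lt <| abs_lt_of_sq_lt_sq
    (sub_pos.1 (pos_of_mul_pos_right hpos (norm_nonneg _))) (norm_nonneg _)
  linarith

theorem inner_focalNormal_sub_left_pos (hk : 0 ≤ k) (hk1 : k < 1) (hA : Z ≠ A) (hB : Z ≠ B) :
    0 < ⟪focalNormal k A B Z, Z - A⟫ := by
  have hr : 0 < dist Z A := dist_pos.2 hA
  have hs : 0 < dist Z B := dist_pos.2 hB
  have cauchy_schwarz : ⟪Z - B, Z - A⟫ ≤ dist Z B * dist Z A := by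
    simpa only [dist_eq_norm] using real_inner_le_norm (Z - B) (Z - A)
  calc 0 < (1 - k) * (dist Z B * dist Z A ^ 2) := by
        have := sub_pos.2 hk1
        positivity
    _ ≤ dist Z B * dist Z A ^ 2 - k * dist Z A * ⟪Z - B, Z - A⟫ := by
        nlinarith [mul_le_mul_of_nonneg_left cauchy_schwarz (mul_nonneg hk hr.le)]
    _ = ⟪focalNormal k A B Z, Z - A⟫ := by
        rw [focalNormal, inner_sub_left (_ • _), real_inner_smul_left, real_inner_smul_left,
          real_inner_self_eq_norm_sq, ← dist_eq_norm Z A]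

theorem convex_focalDiff_le (hk : 0 < k) (hk1 : k < 1) (hb : b ≤ (1 - k) * dist A B) :
    Convex ℝ {x | focalDiff k A B x ≤ b} := by
  rcases le_or_gt b (-(k * dist A B)) with hbA | hbA
  · refine (subsingleton_singleton.anti (t := {A}) fun x hx => ?_).convex
    have hxb : focalDiff k A B x ≤ b := hx
    have hxA : (1 - k) * dist x A ≤ 0 := (mul_dist_le_focalDiff_add hk.le).trans (by linarith)
    exact dist_le_zero.1 (nonpos_of_mul_nonpos_right hxA (sub_pos.2 hk1))
  refine convex_setOf_le_of_supporting (continuous_focalDiff k A B)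
    ((focalDiff_left k A B).trans_lt hbA) fun Z hZ => ?_
  have hZAB : k * dist Z A ≤ dist Z B := mul_dist_le_dist_of_focalDiff_le hk1.le (hZ.trans_le hb)
  refine ⟨innerₛₗ ℝ (focalNormal k A B Z), ?_, fun V hV => ?_⟩
  · have hZA : Z ≠ A := by
      rintro rfl
      exact hbA.ne ((focalDiff_left k Z B).symm.trans hZ)
    have hZB : Z ≠ B := dist_pos.1 ((mul_pos hk (dist_pos.2 hZA)).trans_le hZAB)
    simpa [inner_sub_right] using inner_focalNormal_sub_left_pos hk.le hk1 hZA hZB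
  · by_contra hNV
    have hlt := focalDiff_lt_focalDiff_add_of_inner_pos (h := V - Z) hk.le hk1.le hZAB
      (by simpa [inner_sub_right] using hNV)
    rw [add_sub_cancel, hZ] at hlt
    exact hlt.not_ge hV

theorem sq_norm_add_sub_sq_of_orthogonal (k : ℝ) {z w h : E} (hz : ⟪z, h⟫ = 0) (hw : ⟪w, h⟫ = 0) :
    ‖z + h‖ ^ 2 - (‖z‖ + k * (‖w + h‖ - ‖w‖)) ^ 2 =
      (‖w + h‖ - ‖w‖) * (2 * (‖w‖ - k * ‖z‖) + (1 - k ^ 2) * (‖w + h‖ - ‖w‖)) := by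
  linear_combination norm_add_sq_real z h - norm_add_sq_real w h + 2 * hz - 2 * hw

theorem norm_lt_norm_add_of_inner_eq_zero {w h : E} (hw : ⟪w, h⟫ = 0) (hh : h ≠ 0) :
    ‖w‖ < ‖w + h‖ := by
  refine lt_of_pow_lt_pow_left₀ 2 (norm_nonneg _) ?_
  rw [norm_add_sq_real, hw]
  linarith [pow_pos (norm_pos_iff.2 hh) 2]

theorem focalDiff_lt_focalDiff_add_of_orthogonal (hk : 0 ≤ k) (hk1 : k < 1)
    (hA : ⟪Z - A, h⟫ = 0) (hB : ⟪Z - B, h⟫ = 0) (hh : h ≠ 0) (hZ : k * dist Z A ≤ dist Z B) :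
    focalDiff k A B Z < focalDiff k A B (Z + h) := by
  have identity := sq_norm_add_sub_sq_of_orthogonal k hA hB
  have hw := sub_pos.2 (norm_lt_norm_add_of_inner_eq_zero hB hh)
  simp only [focalDiff, dist_eq_norm, add_sub_right_comm Z h] at hZ ⊢
  have hk2 : 0 < 1 - k ^ 2 := by nlinarith
  have hpos : 0 < ‖Z - A + h‖ ^ 2 - (‖Z - A‖ + k * (‖Z - B + h‖ - ‖Z - B‖)) ^ 2 := by
    rw [identity]
    exact mul_pos hw (by linarith [mul_pos hk2 hw])
  have := lt_of_abs_lt <| abs_lt_of_sq_lt_sq (sub_pos.1 hpos) (norm_nonneg _)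
  linarith

theorem focalDiff_add_lt_focalDiff_of_orthogonal
    (hA : ⟪Z - A, h⟫ = 0) (hB : ⟪Z - B, h⟫ = 0) (hh : h ≠ 0)
    (hZ : dist Z B + ‖h‖ ≤ k * dist Z A) :
    focalDiff k A B (Z + h) < focalDiff k A B Z := by
  have identity := sq_norm_add_sub_sq_of_orthogonal k hA hB
  have hw := sub_pos.2 (norm_lt_norm_add_of_inner_eq_zero hB hh)
  simp only [focalDiff, dist_eq_norm, add_sub_right_comm Z h] at hZ ⊢
  have hneg : ‖Z - A + h‖ ^ 2 - (‖Z - A‖ + k * (‖Z - B + h‖ - ‖Z - B‖)) ^ 2 < 0 := by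
    rw [identity]
    refine mul_neg_of_pos_of_neg hw ?_
    nlinarith [norm_add_le (Z - B) h, mul_nonneg (sq_nonneg k) hw.le, norm_pos_iff.2 hh]
  have hk : 0 < k := pos_of_mul_pos_left
    (((norm_pos_iff.2 hh).trans_le (le_add_of_nonneg_left (norm_nonneg _))).trans_le hZ)
    (norm_nonneg _)
  have := lt_of_pow_lt_pow_left₀ 2 (by positivity) (sub_neg.1 hneg)
  linarith

theorem inner_lineMap_sub_eq_zero (hh : ⟪B - A, h⟫ = 0) (t : ℝ) :
    ⟪lineMap A B t - A, h⟫ = 0 ∧ ⟪lineMap A B t - B, h⟫ = 0 := by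
  rw [← vsub_eq_sub _ A, ← vsub_eq_sub _ B, AffineMap.lineMap_vsub_left,
    AffineMap.lineMap_vsub_right, vsub_eq_sub, vsub_eq_sub, ← neg_sub B A]
  simp only [smul_neg, inner_neg_left, real_inner_smul_left, hh, mul_zero, neg_zero, and_self]

theorem not_convex_focalDiff_le (hE : 1 < Module.rank ℝ E) (hb : (1 - k) * dist A B < b)
    (hb' : b < dist A B) : ¬ Convex ℝ {x | focalDiff k A B x ≤ b} := by
  intro hconv
  have hkp : 0 < k * dist A B := by linarith
  have hk : 0 < k := pos_of_mul_pos_left hkp dist_nonneg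
  have hAB : A ≠ B := dist_pos.1 (pos_of_mul_pos_right hkp hk.le)
  obtain ⟨t, ht, hZ⟩ := exists_focalDiff_lineMap_eq_of_mem_Ioo
    (show -(k * dist A B) < b by linarith [dist_nonneg (x := A) (y := B)]) hb'
  set Z : E := lineMap A B t with hZdef
  have hbetween : dist A Z + dist Z B = dist A B := dist_add_dist_of_mem_segment <| by
    rw [segment_eq_image_lineMap]
    exact mem_image_of_mem _ (Ioo_subset_Icc_self ht)
  have hlt : dist Z B < k * dist Z A := dist_lt_mul_dist_of_lt_focalDiff hbetween (hZ.symm ▸ hb)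
  obtain ⟨h, hnorm, horth⟩ := exists_norm_eq_inner_eq_zero hE (B - A) (sub_pos.2 hlt).le
  have hinterior : ∀ v : E, ‖v‖ = ‖h‖ → ⟪B - A, v⟫ = 0 →
      Z + v ∈ interior {x | focalDiff k A B x ≤ b} := by
    intro v hv hBAv
    have hv0 : v ≠ 0 := norm_pos_iff.1 (by rw [hv, hnorm]; exact sub_pos.2 hlt)
    obtain ⟨hvA, hvB⟩ := inner_lineMap_sub_eq_zero hBAv t
    refine lt_subset_interior_le (continuous_focalDiff k A B) continuous_const ?_
    exact (focalDiff_add_lt_focalDiff_of_orthogonal hvA hvB hv0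
      (by rw [← hZdef, hv, hnorm, add_sub_cancel])).trans_eq hZ
  have hZint : Z ∈ interior {x | focalDiff k A B x ≤ b} :=
    mem_of_convex_of_add_mem_of_add_neg_mem hconv.interior (hinterior h rfl horth)
      (hinterior (-h) (norm_neg h) (by rw [inner_neg_right, horth, neg_zero]))
  exact lineMap_notMem_interior_focalDiff_le (by linarith) hAB ht (hZ.symm ▸ hZint)

theorem exists_focalDiff_eq_not_convex_ball_inter (hE : 1 < Module.rank ℝ E) (hk : 0 ≤ k)
    (hk1 : k < 1) (hAB : A ≠ B) (hb : -(k * dist A B) < b) :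
    ∃ Z, focalDiff k A B Z = b ∧
      ∀ r > 0, ¬ Convex ℝ (ball Z r ∩ {x | focalDiff k A B x ≤ b}ᶜ) := by
  obtain ⟨t, ht, hZ⟩ := exists_focalDiff_lineMap_eq_of_neg hk1 hAB hb
  set Z : E := lineMap A B t
  refine ⟨Z, hZ, fun r hr hconv => ?_⟩
  have hle : k * dist Z A ≤ dist Z B := by
    rw [dist_lineMap_left, dist_lineMap_right, Real.norm_of_nonpos ht.le,
      Real.norm_of_nonneg (by linarith), ← mul_assoc]
    exact mul_le_mul_of_nonneg_right (by nlinarith) dist_nonneg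
  obtain ⟨h, hnorm, horth⟩ := exists_norm_eq_inner_eq_zero hE (B - A) (half_pos hr).le
  have hmem : ∀ v : E, ‖v‖ = ‖h‖ → ⟪B - A, v⟫ = 0 →
      Z + v ∈ ball Z r ∩ {x | focalDiff k A B x ≤ b}ᶜ := by
    intro v hv hBAv
    have hv0 : v ≠ 0 := norm_pos_iff.1 (by rw [hv, hnorm]; exact half_pos hr)
    obtain ⟨hvA, hvB⟩ := inner_lineMap_sub_eq_zero hBAv t
    refine ⟨?_, fun hvb => hvb.not_gt (hZ.symm.trans_lt ?_)⟩
    · rw [mem_ball_iff_norm, add_sub_cancel_left, hv, hnorm]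
      exact half_lt_self hr
    · exact focalDiff_lt_focalDiff_add_of_orthogonal hk hk1 hvA hvB hv0 hle
  exact (mem_of_convex_of_add_mem_of_add_neg_mem hconv (hmem h rfl horth)
    (hmem (-h) (norm_neg h) (by rw [inner_neg_right, horth, neg_zero]))).2 hZ.le

theorem convex_boundedFill_focalDiff (hk : 0 < k) (hk1 : k < 1)
    (hb : b ∈ Icc (-(k * dist A B)) ((1 - k) * dist A B)) :
    Convex ℝ (boundedFill {x | focalDiff k A B x = b}) := by
  rw [boundedFill_focalDiff_eq hk.le hk1 hb.1]
  exact convex_focalDiff_le hk hk1 hb.2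

theorem not_isLocallyConvexOutside_focalDiff (hE : 1 < Module.rank ℝ E) (hk : 0 ≤ k)
    (hk1 : k < 1) (hAB : A ≠ B) (hb : -(k * dist A B) < b) :
    ¬ IsLocallyConvexOutside {x | focalDiff k A B x = b} := by
  intro hconc
  obtain ⟨Z, hZ, hnot⟩ := exists_focalDiff_eq_not_convex_ball_inter hE hk hk1 hAB hb
  obtain ⟨r, hr, hconv⟩ := hconc Z hZ
  rw [boundedFill_focalDiff_eq hk hk1 hb.le] at hconv
  exact hnot r hr hconv

theorem not_convex_and_not_isLocallyConvexOutside_focalDiff (hE : 1 < Module.rank ℝ E)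
    (hk1 : k < 1) (hb : b ∈ Ioo ((1 - k) * dist A B) (dist A B)) :
    ¬ Convex ℝ (boundedFill {x | focalDiff k A B x = b}) ∧
      ¬ IsLocallyConvexOutside {x | focalDiff k A B x = b} := by
  have hkp : 0 < k * dist A B := by linarith [hb.1, hb.2]
  have hk : 0 < k := pos_of_mul_pos_left hkp dist_nonneg
  have hAB : A ≠ B := dist_pos.1 (pos_of_mul_pos_right hkp hk.le)
  have hlow : -(k * dist A B) < b := by linarith [hb.1, dist_pos.2 hAB]
  refine ⟨?_, not_isLocallyConvexOutside_focalDiff hE hk.le hk1 hAB hlow⟩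
  rw [boundedFill_focalDiff_eq hk.le hk1 hlow.le]
  exact not_convex_focalDiff_le hE hb.1 hb.2

end Inner

section Oval

variable {E : Type*} [NormedAddCommGroup E]

/-- The surface `|x| + κ |x - P| = b`. This is `oval` in an arbitrary normed space. -/
def cartesianOval (κ : ℝ) (P : E) (b : ℝ) : Set E := {x | ‖x‖ + κ * ‖x - P‖ = b}

theorem cartesianOval_eq_focalDiff (κ : ℝ) (P : E) (b : ℝ) :
    cartesianOval κ P b = {x | focalDiff (-κ) 0 P x = b} := by
  simp [cartesianOval, focalDiff, dist_eq_norm]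

theorem cartesianOval_eq_focalDiff_swap {κ : ℝ} (hκ : κ ≠ 0) (P : E) (b : ℝ) :
    cartesianOval κ P b = {x | focalDiff (-κ⁻¹) P 0 x = b / κ} := by
  ext x
  rw [cartesianOval, mem_ofPred_eq, mem_ofPred_eq, eq_div_iff hκ, focalDiff, dist_zero_right,
    dist_eq_norm]
  field_simp
  ring_nf

end Oval

theorem theorem3p3_general {E : Type*} [NormedAddCommGroup E] [InnerProductSpace ℝ E]
    (hE : 1 < Module.rank ℝ E) (κ : ℝ) (P : E) :
    (-1 < κ → κ < 0 →
      (∀ b ∈ Icc (κ * ‖P‖) ((1 + κ) * ‖P‖), Convex ℝ (boundedFill (cartesianOval κ P b))) ∧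
      (∀ b ∈ Ioo ((1 + κ) * ‖P‖) ‖P‖, ¬ Convex ℝ (boundedFill (cartesianOval κ P b)) ∧
        ¬ IsLocallyConvexOutside (cartesianOval κ P b))) ∧
    (κ < -1 →
      (∀ b ∈ Ico ((1 + κ) * ‖P‖) ‖P‖, Convex ℝ (boundedFill (cartesianOval κ P b))) ∧
      (∀ b ∈ Ioo (κ * ‖P‖) ((1 + κ) * ‖P‖), ¬ Convex ℝ (boundedFill (cartesianOval κ P b)) ∧
        ¬ IsLocallyConvexOutside (cartesianOval κ P b))) := by
  refine ⟨fun hκ1 hκ0 => ⟨fun b hb => ?_, fun b hb => ?_⟩, fun hκ => ?_⟩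
  · rw [cartesianOval_eq_focalDiff]
    exact convex_boundedFill_focalDiff (by linarith) (by linarith) (by simpa using hb)
  · rw [cartesianOval_eq_focalDiff]
    exact not_convex_and_not_isLocallyConvexOutside_focalDiff hE (by linarith) (by simpa using hb)
  have hκ0 : κ < 0 := by linarith
  have hκinv0 : 0 < -κ⁻¹ := neg_pos.2 (inv_lt_zero.2 hκ0)
  have hκinv1 : -κ⁻¹ < 1 := by
    rw [← inv_neg]
    exact inv_lt_one_of_one_lt₀ (by linarith)
  have hswap : (1 - -κ⁻¹) * ‖P‖ = (1 + κ) * ‖P‖ / κ := by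
    rw [eq_div_iff hκ0.ne]
    linear_combination ‖P‖ * inv_mul_cancel₀ hκ0.ne
  refine ⟨fun b hb => ?_, fun b hb => ?_⟩ <;> rw [cartesianOval_eq_focalDiff_swap hκ0.ne]
  · refine convex_boundedFill_focalDiff hκinv0 hκinv1 ⟨?_, ?_⟩ <;> rw [dist_zero_right]
    · rw [neg_mul, neg_neg, ← div_eq_inv_mul]
      exact div_le_div_of_nonpos_of_le hκ0.le hb.2.le
    · rw [hswap]
      exact div_le_div_of_nonpos_of_le hκ0.le hb.1
  · refine not_convex_and_not_isLocallyConvexOutside_focalDiff hE hκinv1 ⟨?_, ?_⟩ <;>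
      rw [dist_zero_right]
    · rw [hswap]
      exact div_lt_div_of_neg_of_lt hκ0 hb.2
    · rw [div_lt_iff_of_neg' hκ0]
      exact hb.1

theorem theorem3p3 {n : ℕ} (hn : 2 ≤ n) (κ : ℝ) (P : EuclideanSpace ℝ (Fin n)) :
    (-1 < κ → κ < 0 →
      (∀ b ∈ Set.Icc (κ * ‖P‖) ((1 + κ) * ‖P‖), IsConvexSurface (oval κ P b)) ∧
      (∀ b ∈ Set.Ioo ((1 + κ) * ‖P‖) ‖P‖,
        ¬ IsConvexSurface (oval κ P b) ∧ ¬ IsConcaveSurface (oval κ P b))) ∧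
    (κ < -1 →
      (∀ b ∈ Set.Ico ((1 + κ) * ‖P‖) ‖P‖, IsConvexSurface (oval κ P b)) ∧
      (∀ b ∈ Set.Ioo (κ * ‖P‖) ((1 + κ) * ‖P‖),
        ¬ IsConvexSurface (oval κ P b) ∧ ¬ IsConcaveSurface (oval κ P b))) :=
  theorem3p3_general
    (Module.one_lt_rank_of_one_lt_finrank (by rwa [finrank_euclideanSpace_fin])) κ P
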